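/- Let $\gamma,\varepsilon,C_1,C_2\in\mathbb C$ and $q=(\gamma-1)\varepsilon\neq 0$. Assume $\operatorname{Re}\varepsilon>-1$, $\gamma\notin\{-2,-4,-6,\dots\}$, and either $\operatorname{Re}\gamma<1$ or $C_1=0$ (in the latter case the $C_1$-terms below are absent). For $z\in[0,1]$ let $$u(z)=C_1\int_0^z(1-t)^{\varepsilon}t^{-\gamma}\,{}_2F_1\!\left(\tfrac{\varepsilon}{2},1+\tfrac{\varepsilon-\gamma}{2};1-\tfrac{\gamma}{2};t^2\right)dt+C_2\left(-\frac{\gamma}{q}+\int_0^z(1-t)^{\varepsilon}\,{}_2F_1\!\left(1+\tfrac{\varepsilon}{2},\tfrac{\varepsilon+\gamma}{2};1+\tfrac{\gamma}{2};t^2\right)dt\right).$$ (This is the general solution in quadratures, on that interval, of the Heun equation $u''+\left(\frac{\gamma}{z}+\frac{\delta}{z-1}+\frac{\varepsilon}{z-a}\right)u'+\frac{\alpha\beta z-q}{z(z-1)(z-a)}u=0$, $1+\alpha+\beta=\gamma+\delta+\varepsilon$, with $a=-1$, $\delta=-\varepsilon$, $\alpha\beta=0$, $q=(\gamma-1)\varepsilon$;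 this is background, not part of the claim.) Then the second integral converges absolutely at $z=1$, and so does the first if $\operatorname{Re}\gamma<1$; the series ${}_3F_2\left(\tfrac12,1,\tfrac{\varepsilon+\gamma}{2};1+\tfrac{\gamma}{2},\tfrac32+\tfrac{\varepsilon}{2};1\right)$ converges absolutely; $u(z)\to u(1)$ as $z\to1^-$; and $$u(1)=C_1\frac{\Gamma\left(1-\frac{\gamma}{2}\right)\Gamma\left(\frac12+\frac{\varepsilon}{2}\right)}{\sqrt{\pi}\,(1-\gamma)\,\Gamma\left(1+\frac{\varepsilon}{2}-\frac{\gamma}{2}\right)}+C_2\left(-\frac{\gamma}{q}+\frac{1}{1+\varepsilon}\,{}_3F_2\!\left(\tfrac12,1,\tfrac{\varepsilon+\gamma}{2};1+\tfrac{\gamma}{2},\tfrac32+\tfrac{\varepsilon}{2};1\right)\right).$$ If in addition $\gamma+\varepsilon=-2N$ with $N\in\{1,2,\dots\}$, then this ${}_3F_2$ is Saalschützian (the sum of its lower parameters minus the sum of its upper parameters is $1$, and one upper parameter is a negative integer), and $${}_3F_2\!\left(\tfrac12,1,\tfrac{\varepsilon+\gamma}{2};1+\tfrac{\gamma}{2},\tfrac32+\tfrac{\varepsilon}{2};1\right)=\frac{\Gamma\left(\frac12-\frac{\gamma}{2}\right)\Gamma\left(1-\frac{\gamma}{2}\right)\Gamma\left(\frac{\varepsilon}{2}\right)\Gamma\left(\frac32+\frac{\varepsilon}{2}\right)}{\Gamma\left(\frac32-\frac{\gamma}{2}\right)\Gamma\left(-\frac{\gamma}{2}\right)\Gamma\left(1+\frac{\varepsilon}{2}\right)\Gamma\left(\frac12+\frac{\varepsilon}{2}\right)},$$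 so that $u(1)$ is expressed through Gamma functions by substituting this in the formula for $u(1)$; after substitution the factor of $C_2$ vanishes, and $$u(1)=C_1\frac{\Gamma\left(1-\frac{\gamma}{2}\right)\Gamma\left(\frac12+\frac{\varepsilon}{2}\right)}{\sqrt{\pi}\,(1-\gamma)\,\Gamma\left(1+\frac{\varepsilon}{2}-\frac{\gamma}{2}\right)}.$$ -/

import Mathlib

open Filter Topology

/-- The `n`-th term `(a)ₙ (b)ₙ (c)ₙ / ((d)ₙ (e)ₙ n!)` of Clausen's series at unit argument. -/
noncomputable def clausenTerm (a b c d e : ℂ) (n : ℕ) : ℂ :=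
  ((ascPochhammer ℂ n).eval a * (ascPochhammer ℂ n).eval b * (ascPochhammer ℂ n).eval c) /
    ((ascPochhammer ℂ n).eval d * (ascPochhammer ℂ n).eval e * (n.factorial : ℂ))

/-- Clausen's hypergeometric function `₃F₂(a, b, c; d, e; 1)` at unit argument. -/
noncomputable def clausen (a b c d e : ℂ) : ℂ :=
  ∑' n : ℕ, clausenTerm a b c d e n

/-- `₃F₂(a, b, c; d, e; 1)` is Saalschützian: its parametric excess `d + e - a - b - c` is `1`
and one of its upper parameters is a negative integer. -/
def IsSaalschutzian (a b c d e : ℂ) : Prop :=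
  (d + e) - (a + b + c) = 1 ∧ ∃ N : ℕ, 1 ≤ N ∧ (a = -(N : ℂ) ∨ b = -(N : ℂ) ∨ c = -(N : ℂ))

/-- The first integrand
`(1 - z)^ε z^(-γ) ₂F₁(ε/2, 1 + (ε - γ)/2; 1 - γ/2; z²)`, for real `z` between `0` and `1`. -/
noncomputable def heunIntegrand₁ (γ ε : ℂ) (z : ℝ) : ℂ :=
  (1 - (z : ℂ)) ^ ε * (z : ℂ) ^ (-γ) *
    ₂F₁ (ε / 2) (1 + (ε - γ) / 2) (1 - γ / 2) ((z : ℂ) ^ 2)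

/-- The second integrand
`(1 - z)^ε ₂F₁(1 + ε/2, (ε + γ)/2; 1 + γ/2; z²)`, for real `z` between `0` and `1`. -/
noncomputable def heunIntegrand₂ (γ ε : ℂ) (z : ℝ) : ℂ :=
  (1 - (z : ℂ)) ^ ε * ₂F₁ (1 + ε / 2) ((ε + γ) / 2) (1 + γ / 2) ((z : ℂ) ^ 2)

/-- The solution of the Heun equation with singular points `0, 1, -1, ∞`, exponent parameters
`γ`, `δ = -ε`, `ε`, `αβ = 0` and accessory parameter `q = (γ - 1) ε`, written in quadratures,
on the real interval `[0, 1]`. -/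
noncomputable def heunSolution (γ ε q C₁ C₂ : ℂ) (z : ℝ) : ℂ :=
  C₁ * (∫ t in (0 : ℝ)..z, heunIntegrand₁ γ ε t) +
    C₂ * (-γ / q + ∫ t in (0 : ℝ)..z, heunIntegrand₂ γ ε t)

/-!
Both integrals are computed by expanding the `₂F₁` in powers of `t²` and integrating term by term.
In either case the parameters satisfy `a + b - c = ε`, so the coefficients are `O(n^(Re ε - 1))`,
while the Beta integral of the `n`-th term is `O(n^(-1 - Re ε))`; the resulting series is dominated
by `∑ n⁻²` for every `ε` with `Re ε > -1`, and no case distinction on the behaviour of the `₂F₁` at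
`1` is needed (`integral_betaKernel_mul_hypergeometric`). The bounds come from Euler's limit formula
`(s)ₙ ∼ n! n^(s-1) / Γ(s)` (`tendsto_ascPochhammer_div_factorial_mul_cpow`).

Since `Β(u + 2n, v) / Β(u, v)` is a quotient of four Pochhammer symbols, two of which are
parameters of the first `₂F₁` and one of which is a parameter of the second, the first integral
becomes a `₂F₁` at `1` and the second a `₃F₂` at `1`. The `₂F₁` has parametric excess `1`, where
Gauss' formula is a telescoping sum (`hasSum_gauss_of_eq_add_add_one`); the duplication formula for
`Γ` simplifies the result. The `₃F₂` has an upper parameter `1` and excess `1`, so that it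
telescopes as well, and when `γ + ε = -2N` its sum is `γ (1 + ε) / q`
(`clausen_one_neg_nat`, `clausen_saalschutz`). This is also the value of the quotient of Gamma
functions, and it cancels `-γ / q` in the factor of `C₂`.
-/

/-! ### Growth of Pochhammer symbols -/

/-- Euler's limit formula for `Γ`, in the form `(s)ₙ ∼ n! n^(s-1) / Γ(s)`. It holds for every `s`:
at the poles of `Γ` the left side is eventually `0`, and so is the limit, as `Complex.Gamma s = 0`
there. -/
theorem tendsto_ascPochhammer_div_factorial_mul_cpow (s : ℂ) :
    Tendsto (fun n : ℕ => (ascPochhammer ℂ n).eval s / ((n.factorial : ℂ) * (n : ℂ) ^ (s - 1)))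
      atTop (𝓝 (Complex.Gamma s)⁻¹) := by
  by_cases hs : ∃ m : ℕ, s = -m
  · rw [(Complex.Gamma_eq_zero_iff s).2 hs, inv_zero]
    obtain ⟨m, rfl⟩ := hs
    refine tendsto_const_nhds.congr' ?_
    filter_upwards [eventually_gt_atTop m] with n hn
    rw [ascPochhammer_eval_neg_coe_nat_of_lt hn, zero_div]
  · push Not at hs
    have h1 := (Complex.GammaSeq_tendsto_Gamma s).inv₀ (Complex.Gamma_ne_zero hs)
    have h2 : Tendsto (fun n : ℕ => (n : ℂ) / (n + s)) atTop (𝓝 1) :=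
      tendsto_natCast_div_add_atTop s
    have h3 := h2.mul h1
    rw [one_mul] at h3
    refine h3.congr' ?_
    filter_upwards [eventually_gt_atTop 0] with n hn
    have hn' : (n : ℂ) ≠ 0 := by exact_mod_cast hn.ne'
    have hns : (n : ℂ) + s ≠ 0 := fun h => hs n (by linear_combination h)
    have hprod : ∏ j ∈ Finset.range (n + 1), (s + j) = (ascPochhammer ℂ n).eval s * (s + n) := by
      rw [← ascPochhammer_succ_eval]
      induction n + 1 with
      | zero => simp
      | succ k ih => rw [Finset.prod_range_succ, ih, ascPochhammer_succ_eval]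
    have hpow : (n : ℂ) ^ s ≠ 0 := by simp [Complex.cpow_eq_zero_iff, hn']
    have hfac : (n.factorial : ℂ) ≠ 0 := by exact_mod_cast n.factorial_ne_zero
    rw [Complex.GammaSeq, hprod, Complex.cpow_sub _ _ hn', Complex.cpow_one]
    field_simp
    ring

/-- The quotient `(a)ₙ / (b)ₙ` behaves like `Γ(b) / Γ(a) * n^(a-b)`. -/
theorem tendsto_ascPochhammer_div_ascPochhammer (a b : ℂ) (hb : ∀ k : ℕ, b ≠ -k) :
    Tendsto (fun n : ℕ => (ascPochhammer ℂ n).eval a / (ascPochhammer ℂ n).eval b *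
      (n : ℂ) ^ (b - a)) atTop (𝓝 (Complex.Gamma b / Complex.Gamma a)) := by
  have h := (tendsto_ascPochhammer_div_factorial_mul_cpow a).div
    (tendsto_ascPochhammer_div_factorial_mul_cpow b) (inv_ne_zero (Complex.Gamma_ne_zero hb))
  rw [show (Complex.Gamma a)⁻¹ / (Complex.Gamma b)⁻¹ = Complex.Gamma b / Complex.Gamma a by
    field_simp] at h
  refine h.congr' ?_
  filter_upwards [eventually_gt_atTop 0] with n hn
  have hn' : (n : ℂ) ≠ 0 := by exact_mod_cast hn.ne'
  have hfac : (n.factorial : ℂ) ≠ 0 := by exact_mod_cast n.factorial_ne_zero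
  have hp : ∀ s : ℂ, (n : ℂ) ^ s ≠ 0 := fun s => by simp [Complex.cpow_eq_zero_iff, hn']
  have e : (n : ℂ) ^ (b - a) = (n : ℂ) ^ (b - 1) / (n : ℂ) ^ (a - 1) := by
    rw [← Complex.cpow_sub _ _ hn']; ring_nf
  simp only [Pi.div_apply]
  rw [e]
  have := hp (a - 1)
  have := hp (b - 1)
  field_simp

theorem isBigO_ascPochhammer_div_ascPochhammer (a b : ℂ) (hb : ∀ k : ℕ, b ≠ -k) :
    (fun n : ℕ => (ascPochhammer ℂ n).eval a / (ascPochhammer ℂ n).eval b) =O[atTop]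
      fun n : ℕ => (n : ℝ) ^ (a.re - b.re) := by
  have h := (tendsto_ascPochhammer_div_ascPochhammer a b hb).isBigO_one ℝ
  have h2 := h.norm_left.mul
    (Asymptotics.isBigO_refl (fun n : ℕ => (n : ℝ) ^ (a.re - b.re)) atTop)
  refine (Asymptotics.IsBigO.of_norm_left (h2.congr' ?_ ?_))
  · filter_upwards [eventually_gt_atTop 0] with n hn
    have hn' : (0 : ℝ) < n := by exact_mod_cast hn
    rw [norm_mul, Complex.norm_natCast_cpow_of_pos hn, Complex.sub_re, mul_assoc,
      ← Real.rpow_add hn']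
    simp
  · exact .of_forall fun n => one_mul _

/-- The convergence criterion for products of three factors of polynomial growth, such as
quotients of Pochhammer symbols. -/
theorem summable_of_isBigO_rpow_mul_rpow_mul_rpow {E : Type*} [NormedAddCommGroup E]
    [CompleteSpace E] {f : ℕ → E} {x y z : ℝ}
    (h : f =O[atTop] fun n : ℕ => (n : ℝ) ^ x * (n : ℝ) ^ y * (n : ℝ) ^ z)
    (hxyz : x + y + z < -1) : Summable f := by
  refine summable_of_isBigO_nat (Real.summable_nat_rpow.2 hxyz) (h.trans_eventuallyEq ?_)
  filter_upwards [eventually_gt_atTop 0] with n hn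
  have hn' : (0 : ℝ) < n := by exact_mod_cast hn
  rw [Real.rpow_add hn', Real.rpow_add hn']

theorem ne_neg_natCast_of_re_pos {s : ℂ} (hs : 0 < s.re) (k : ℕ) : s ≠ -k := by
  rintro rfl
  have : (0 : ℝ) ≤ k := k.cast_nonneg
  simp at hs
  linarith

theorem ascPochhammer_eval_ne_zero {s : ℂ} (hs : ∀ k : ℕ, s ≠ -k) (n : ℕ) :
    (ascPochhammer ℂ n).eval s ≠ 0 := by
  rw [Ne, ascPochhammer_eval_eq_zero_iff]
  rintro ⟨k, -, hk⟩
  exact hs k (by rw [hk, neg_neg])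

theorem summable_clausenTerm {a b c d e : ℂ} (hd : ∀ k : ℕ, d ≠ -k) (he : ∀ k : ℕ, e ≠ -k)
    (h : a.re + b.re + c.re < d.re + e.re) : Summable (clausenTerm a b c d e) := by
  have h1 := isBigO_ascPochhammer_div_ascPochhammer a d hd
  have h2 := isBigO_ascPochhammer_div_ascPochhammer b e he
  have h3 := isBigO_ascPochhammer_div_ascPochhammer c 1 (ne_neg_natCast_of_re_pos (by simp))
  refine summable_of_isBigO_rpow_mul_rpow_mul_rpow (((h1.mul h2).mul h3).congr_left fun n => ?_)
    (by simp; linarith)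
  rw [ascPochhammer_eval_one, clausenTerm, div_mul_div_comm, div_mul_div_comm]

/-! ### Two telescoping hypergeometric sums -/

theorem ascPochhammer_eval_succ_left (n : ℕ) (s : ℂ) :
    (ascPochhammer ℂ (n + 1)).eval s = s * (ascPochhammer ℂ n).eval (s + 1) := by
  simp [ascPochhammer_succ_left, Polynomial.eval_comp]

/-- Gauss' summation formula in the case `c - a - b = 1`: the partial sums have the closed form
`(a+1)ₙ (b+1)ₙ / ((a+b+1)ₙ n!)`. -/
theorem hasSum_gauss_of_eq_add_add_one {a b : ℂ} (h : ∀ k : ℕ, a + b + 1 ≠ -k) :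
    HasSum (fun n : ℕ => (ascPochhammer ℂ n).eval a * (ascPochhammer ℂ n).eval b /
        ((ascPochhammer ℂ n).eval (a + b + 1) * (n.factorial : ℂ)))
      (Complex.Gamma (a + b + 1) / (Complex.Gamma (a + 1) * Complex.Gamma (b + 1))) := by
  have h1 : ∀ k : ℕ, (1 : ℂ) ≠ -k := ne_neg_natCast_of_re_pos (by simp)
  have hsum : Summable (fun n : ℕ => (ascPochhammer ℂ n).eval a * (ascPochhammer ℂ n).eval b /
      ((ascPochhammer ℂ n).eval (a + b + 1) * (n.factorial : ℂ))) := by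
    have hA := isBigO_ascPochhammer_div_ascPochhammer a _ h
    have hB := isBigO_ascPochhammer_div_ascPochhammer b 1 h1
    have hC := isBigO_ascPochhammer_div_ascPochhammer 1 1 h1
    refine summable_of_isBigO_rpow_mul_rpow_mul_rpow
      (((hA.mul hB).mul hC).congr_left fun n => ?_) (by simp; linarith)
    rw [div_self (ascPochhammer_eval_ne_zero h1 n), ascPochhammer_eval_one, mul_one,
      div_mul_div_comm]
  have hpartial : ∀ n : ℕ, ∑ k ∈ Finset.range (n + 1),
      (ascPochhammer ℂ k).eval a * (ascPochhammer ℂ k).eval b /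
        ((ascPochhammer ℂ k).eval (a + b + 1) * (k.factorial : ℂ)) =
      (ascPochhammer ℂ n).eval (a + 1) * (ascPochhammer ℂ n).eval (b + 1) /
        ((ascPochhammer ℂ n).eval (a + b + 1) * (n.factorial : ℂ)) := by
    intro n
    induction n with
    | zero => simp
    | succ n ih =>
      rw [Finset.sum_range_succ, ih, ascPochhammer_eval_succ_left n a,
        ascPochhammer_eval_succ_left n b]
      have hn := ascPochhammer_eval_ne_zero h n
      have hn1 := ascPochhammer_eval_ne_zero h (n + 1)
      rw [ascPochhammer_succ_eval] at hn1
      have hn2 := right_ne_zero_of_mul hn1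
      have hf : (n.factorial : ℂ) ≠ 0 := by exact_mod_cast n.factorial_ne_zero
      have hn3 : (n : ℂ) + 1 ≠ 0 := by exact_mod_cast n.succ_ne_zero
      rw [ascPochhammer_succ_eval, ascPochhammer_succ_eval, ascPochhammer_succ_eval,
        Nat.factorial_succ]
      push_cast
      field_simp
      ring
  refine hsum.hasSum_iff_tendsto_nat.2 ((tendsto_add_atTop_iff_nat 1).1 ?_)
  simp_rw [hpartial]
  have hA := (tendsto_ascPochhammer_div_ascPochhammer (a + 1) _ h).mul
    (tendsto_ascPochhammer_div_ascPochhammer (b + 1) 1 h1)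
  rw [Complex.Gamma_one, div_mul_div_comm, mul_one] at hA
  refine hA.congr' ?_
  filter_upwards [eventually_gt_atTop 0] with n hn
  have hn' : (n : ℂ) ≠ 0 := by exact_mod_cast hn.ne'
  rw [mul_mul_mul_comm, ← Complex.cpow_add _ _ hn', ascPochhammer_eval_one, div_mul_div_comm]
  ring_nf
  simp

/-- The terminating Saalschützian series `₃F₂(a, 1, -N; d, e; 1)`: the quotients
`(a)ₙ (-N)ₙ / ((d)ₙ₋₁ (e)ₙ₋₁)` telescope to it, since `(a + n) (n - N)` and
`(d + n - 1) (e + n - 1)` differ by a quantity that does not depend on `n`. -/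
theorem clausen_one_neg_nat {a d e : ℂ} {N : ℕ} (hd : ∀ k : ℕ, d ≠ -k) (he : ∀ k : ℕ, e ≠ -k)
    (hs : d + e - (a + 1 + -N) = 1) (hK : (d - 1) * (e - 1) + a * N ≠ 0) :
    clausen a 1 (-N) d e = (d - 1) * (e - 1) / ((d - 1) * (e - 1) + a * N) := by
  have hpartial : ∀ n : ℕ, ∑ k ∈ Finset.range (n + 1), clausenTerm a 1 (-N) d e k =
      ((d - 1) * (e - 1) - (ascPochhammer ℂ (n + 1)).eval a *
        (ascPochhammer ℂ (n + 1)).eval (-N : ℂ) /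
        ((ascPochhammer ℂ n).eval d * (ascPochhammer ℂ n).eval e)) /
          ((d - 1) * (e - 1) + a * N) := by
    intro n
    rw [eq_div_iff hK]
    induction n with
    | zero => simp [clausenTerm]
    | succ n ih =>
      rw [Finset.sum_range_succ, add_mul, ih, clausenTerm, ascPochhammer_eval_one]
      have hf : ((n + 1).factorial : ℂ) ≠ 0 := by exact_mod_cast (n + 1).factorial_ne_zero
      have hd1 := ascPochhammer_eval_ne_zero hd (n + 1)
      have he1 := ascPochhammer_eval_ne_zero he (n + 1)
      rw [ascPochhammer_succ_eval] at hd1 he1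
      have hd2 := right_ne_zero_of_mul hd1
      have he2 := right_ne_zero_of_mul he1
      have hd3 := left_ne_zero_of_mul hd1
      have he3 := left_ne_zero_of_mul he1
      rw [ascPochhammer_succ_eval (n + 1), ascPochhammer_succ_eval (n + 1),
        ascPochhammer_succ_eval n d, ascPochhammer_succ_eval n e]
      obtain rfl : e = a + 2 - N - d := by linear_combination hs
      push_cast
      field_simp
      ring
  have hzero : ∀ n ∉ Finset.range (N + 1), clausenTerm a 1 (-N) d e n = 0 := by
    intro n hn
    rw [Finset.mem_range, not_lt] at hn
    rw [clausenTerm, ascPochhammer_eval_neg_coe_nat_of_lt (by omega : N < n)]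
    simp
  rw [clausen, tsum_eq_sum hzero, hpartial, ascPochhammer_eval_neg_coe_nat_of_lt N.lt_succ_self]
  simp

/-! ### Termwise integration against a Beta weight -/

open MeasureTheory in
theorem integrable_tsum_of_summable_integral_norm {α E ι : Type*} [MeasurableSpace α]
    {μ : Measure α} [NormedAddCommGroup E] [CompleteSpace E] [Countable ι] {F : ι → α → E}
    (hF : ∀ i, Integrable (F i) μ) (hsum : Summable fun i => ∫ a, ‖F i a‖ ∂μ) :
    Integrable (fun a => ∑' i, F i a) μ := by
  have hfin : ∫⁻ a, ∑' i, ‖F i a‖ₑ ∂μ ≠ ⊤ := by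
    rw [lintegral_tsum fun i => (hF i).1.enorm]
    have (i : ι) : ∫⁻ a, ‖F i a‖ₑ ∂μ = ENNReal.ofReal (∫ a, ‖F i a‖ ∂μ) :=
      (ofReal_integral_norm_eq_lintegral_enorm (hF i)).symm
    rw [funext this]
    exact hsum.tsum_ofReal_ne_top
  have hae : ∀ᵐ a ∂μ, Summable fun i => F i a := by
    filter_upwards [ae_lt_top' (AEMeasurable.tsum fun i => (hF i).1.enorm) hfin] with a ha
    exact Summable.of_nnnorm (ENNReal.tsum_coe_ne_top_iff_summable.1 ha.ne)
  refine ⟨aestronglyMeasurable_of_tendsto_ae (atTop : Filter (Finset ι))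
    (f := fun s a => ∑ i ∈ s, F i a)
    (fun s => (integrable_finsetSum s fun i _ => hF i).1) (hae.mono fun a ha => ha.hasSum), ?_⟩
  exact (lintegral_mono fun a => enorm_tsum_le_tsum_enorm).trans_lt hfin.lt_top

theorem norm_betaKernel (u v : ℂ) {t : ℝ} (ht : t ∈ Set.Ioo (0 : ℝ) 1) :
    (‖(t : ℂ) ^ (u - 1) * (1 - (t : ℂ)) ^ (v - 1)‖ : ℂ) =
      (t : ℂ) ^ ((u.re : ℂ) - 1) * (1 - (t : ℂ)) ^ ((v.re : ℂ) - 1) := by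
  have h1 : (0 : ℝ) < 1 - t := by linarith [ht.2]
  rw [norm_mul, Complex.norm_cpow_eq_rpow_re_of_pos ht.1,
    show (1 - (t : ℂ)) = ((1 - t : ℝ) : ℂ) by push_cast; rfl,
    Complex.norm_cpow_eq_rpow_re_of_pos h1]
  push_cast [Complex.ofReal_cpow ht.1.le, Complex.ofReal_cpow h1.le]
  simp

theorem integral_norm_betaKernel (u v : ℂ) :
    ∫ t in Set.Ioo (0 : ℝ) 1, ‖(t : ℂ) ^ (u - 1) * (1 - (t : ℂ)) ^ (v - 1)‖ =
      ‖Complex.betaIntegral u.re v.re‖ := by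
  have h : Complex.betaIntegral u.re v.re =
      ((∫ t in Set.Ioo (0 : ℝ) 1, ‖(t : ℂ) ^ (u - 1) * (1 - (t : ℂ)) ^ (v - 1)‖ : ℝ) : ℂ) := by
    rw [Complex.betaIntegral, intervalIntegral.integral_of_le zero_le_one,
      MeasureTheory.integral_Ioc_eq_integral_Ioo, ← integral_complex_ofReal]
    exact MeasureTheory.setIntegral_congr_fun measurableSet_Ioo fun t ht =>
      (norm_betaKernel u v ht).symm
  rw [h, Complex.norm_real,
    Real.norm_of_nonneg (MeasureTheory.integral_nonneg fun _ => norm_nonneg _)]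

/-- Termwise integration of a power series in `t²` against `t^(u-1) (1-t)^(v-1)`, under absolute
convergence of the resulting series of Beta integrals. -/
theorem integral_betaKernel_mul_tsum {u v : ℂ} (hu : 0 < u.re) (hv : 0 < v.re) {c : ℕ → ℂ}
    (hc : Summable fun n => ‖c n‖ * ‖Complex.betaIntegral ((u + 2 * n).re : ℝ) (v.re : ℝ)‖) :
    IntervalIntegrable (fun t : ℝ => (1 - (t : ℂ)) ^ (v - 1) * (t : ℂ) ^ (u - 1) *
      ∑' n, c n * ((t : ℂ) ^ 2) ^ n) MeasureTheory.volume 0 1 ∧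
    ∫ t in (0 : ℝ)..1, (1 - (t : ℂ)) ^ (v - 1) * (t : ℂ) ^ (u - 1) *
      ∑' n, c n * ((t : ℂ) ^ 2) ^ n = ∑' n, c n * Complex.betaIntegral (u + 2 * n) v := by
  set F : ℕ → ℝ → ℂ := fun n t =>
    c n * ((t : ℂ) ^ (u + 2 * n - 1) * (1 - (t : ℂ)) ^ (v - 1)) with hF
  have hun : ∀ n : ℕ, 0 < (u + 2 * n).re := fun n => by
    have : (0 : ℝ) ≤ n := n.cast_nonneg
    simp
    linarith
  have hint : ∀ n, MeasureTheory.IntegrableOn (F n) (Set.Ioo 0 1) := fun n =>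
    MeasureTheory.Integrable.const_mul
      ((intervalIntegrable_iff_integrableOn_Ioo_of_le zero_le_one).1
        (Complex.betaIntegral_convergent (hun n) hv)) _
  have hnorm : ∀ n, ∫ t in Set.Ioo (0 : ℝ) 1, ‖F n t‖ =
      ‖c n‖ * ‖Complex.betaIntegral ((u + 2 * n).re : ℝ) (v.re : ℝ)‖ := fun n => by
    simp only [hF, norm_mul (c n)]
    rw [MeasureTheory.integral_const_mul, integral_norm_betaKernel]
  have hsum : Summable fun n => ∫ t in Set.Ioo (0 : ℝ) 1, ‖F n t‖ := by
    simpa only [hnorm] using hc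
  have heq : ∀ t ∈ Set.Ioo (0 : ℝ) 1, ∑' n, F n t = (1 - (t : ℂ)) ^ (v - 1) * (t : ℂ) ^ (u - 1) *
      ∑' n, c n * ((t : ℂ) ^ 2) ^ n := by
    intro t ht
    rw [← tsum_mul_left]
    refine tsum_congr fun n => ?_
    have ht0 : (t : ℂ) ≠ 0 := by exact_mod_cast ht.1.ne'
    have e : (t : ℂ) ^ (u + 2 * n - 1) = (t : ℂ) ^ (u - 1) * ((t : ℂ) ^ 2) ^ n := by
      rw [← pow_mul, ← Complex.cpow_natCast, ← Complex.cpow_add _ _ ht0]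
      push_cast
      ring_nf
    simp only [hF]
    rw [e]
    ring
  constructor
  · rw [intervalIntegrable_iff_integrableOn_Ioo_of_le zero_le_one]
    exact (integrable_tsum_of_summable_integral_norm hint hsum).congr
      (MeasureTheory.ae_restrict_of_forall_mem measurableSet_Ioo heq)
  · rw [intervalIntegral.integral_of_le zero_le_one, MeasureTheory.integral_Ioc_eq_integral_Ioo,
      ← MeasureTheory.setIntegral_congr_fun measurableSet_Ioo heq,
      ← MeasureTheory.integral_tsum_of_summable_integral_norm hint hsum]
    refine tsum_congr fun n => ?_
    rw [MeasureTheory.integral_const_mul, Complex.betaIntegral,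
      intervalIntegral.integral_of_le zero_le_one, MeasureTheory.integral_Ioc_eq_integral_Ioo]

/-- `Β(u + 2n, v) / Β(u, v) = (u)₂ₙ / (u + v)₂ₙ`, the symbols `(x)₂ₙ` being split as
`4ⁿ (x/2)ₙ ((x+1)/2)ₙ`. -/
theorem betaIntegral_add_two_mul {u v : ℂ} (hu : 0 < u.re) (hv : 0 < v.re) (n : ℕ) :
    Complex.betaIntegral (u + 2 * n) v = Complex.betaIntegral u v *
      ((ascPochhammer ℂ n).eval (u / 2) / (ascPochhammer ℂ n).eval ((u + v) / 2) *
        ((ascPochhammer ℂ n).eval ((u + 1) / 2) /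
          (ascPochhammer ℂ n).eval ((u + v + 1) / 2))) := by
  induction n with
  | zero => simp
  | succ n ih =>
    have hn0 : (0 : ℝ) ≤ n := n.cast_nonneg
    have hun : 0 < (u + 2 * n).re := by simp; linarith
    have huv : 0 < (u + v + 2 * n).re := by simp; linarith
    have hstep : Complex.betaIntegral (u + 2 * n + 2) v = Complex.betaIntegral (u + 2 * n) v *
        ((u + 2 * n) * (u + 2 * n + 1) / ((u + v + 2 * n) * (u + v + 2 * n + 1))) := by
      have h1 : (u + 2 * n : ℂ) ≠ 0 := fun h => by rw [h] at hun; simp at hun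
      have h2 : (u + v + 2 * n : ℂ) ≠ 0 := fun h => by rw [h] at huv; simp at huv
      have hun1 : 0 < (u + 2 * n + 1).re := by
        rw [Complex.add_re, Complex.one_re]; linarith
      have huv1 : 0 < (u + v + 2 * n + 1).re := by
        rw [Complex.add_re, Complex.one_re]; linarith
      have h3 : (u + 2 * n + 1 : ℂ) ≠ 0 := fun h => by rw [h] at hun1; simp at hun1
      have h4 : (u + v + 2 * n + 1 : ℂ) ≠ 0 := fun h => by rw [h] at huv1; simp at huv1
      have hG := Complex.Gamma_ne_zero_of_re_pos huv
      rw [Complex.betaIntegral_eq_Gamma_mul_div _ _ (by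
          rw [Complex.add_re]; norm_num; linarith [hun]) hv,
        Complex.betaIntegral_eq_Gamma_mul_div _ _ hun hv,
        show u + 2 * n + 2 + v = u + v + 2 * n + 1 + 1 by ring,
        show u + 2 * n + 2 = u + 2 * n + 1 + 1 by ring,
        show u + 2 * n + v = u + v + 2 * n by ring,
        Complex.Gamma_add_one _ h3, Complex.Gamma_add_one _ h1, Complex.Gamma_add_one _ h4,
        Complex.Gamma_add_one _ h2]
      field_simp
    have hP := ascPochhammer_eval_ne_zero (s := (u + v) / 2)
      (ne_neg_natCast_of_re_pos (by simp; linarith)) (n + 1)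
    have hQ := ascPochhammer_eval_ne_zero (s := (u + v + 1) / 2)
      (ne_neg_natCast_of_re_pos (by simp; linarith)) (n + 1)
    rw [ascPochhammer_succ_eval] at hP hQ
    have hP1 := left_ne_zero_of_mul hP
    have hP2 := right_ne_zero_of_mul hP
    have hQ1 := left_ne_zero_of_mul hQ
    have hQ2 := right_ne_zero_of_mul hQ
    have hP3 : u + v + 2 * n ≠ 0 := fun h => hP2 (by linear_combination h / 2)
    have hQ3 : u + v + 2 * n + 1 ≠ 0 := fun h => hQ2 (by linear_combination h / 2)
    rw [show u + 2 * ((n + 1 : ℕ) : ℂ) = u + 2 * n + 2 by push_cast; ring, hstep, ih]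
    simp only [ascPochhammer_succ_eval]
    rw [show u / 2 + n = (u + 2 * n) / 2 by ring,
      show (u + v) / 2 + n = (u + v + 2 * n) / 2 by ring,
      show (u + 1) / 2 + n = (u + 2 * n + 1) / 2 by ring,
      show (u + v + 1) / 2 + n = (u + v + 2 * n + 1) / 2 by ring]
    field_simp

theorem isBigO_betaIntegral_add_two_mul {u v : ℂ} (hu : 0 < u.re) (hv : 0 < v.re) :
    (fun n : ℕ => Complex.betaIntegral (u + 2 * n) v) =O[atTop]
      fun n : ℕ => (n : ℝ) ^ (-v.re) := by
  have h1 := isBigO_ascPochhammer_div_ascPochhammer (u / 2) ((u + v) / 2)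
    (ne_neg_natCast_of_re_pos (by simp; linarith))
  have h2 := isBigO_ascPochhammer_div_ascPochhammer ((u + 1) / 2) ((u + v + 1) / 2)
    (ne_neg_natCast_of_re_pos (by simp; linarith))
  have h3 := (h1.mul h2).const_mul_left (Complex.betaIntegral u v)
  refine (h3.congr_left fun n => (betaIntegral_add_two_mul hu hv n).symm).trans_eventuallyEq ?_
  filter_upwards [eventually_gt_atTop 0] with n hn
  have hn' : (0 : ℝ) < n := by exact_mod_cast hn
  rw [← Real.rpow_add hn']
  congr 1
  simp
  ring

/-- The integral of `(1-t)^(v-1) t^(u-1) ₂F₁(a, b; c; t²)` over `[0, 1]`. When `a + b - c = v - 1`,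
the coefficients of `₂F₁` are `O(n^(Re v - 2))` while the Beta integrals are `O(n^(-Re v))`, so that
the resulting series always converges absolutely. -/
theorem integral_betaKernel_mul_hypergeometric {u v a b c : ℂ} (hu : 0 < u.re) (hv : 0 < v.re)
    (hc : ∀ k : ℕ, c ≠ -k) (habc : a + b - c = v - 1) :
    IntervalIntegrable (fun t : ℝ => (1 - (t : ℂ)) ^ (v - 1) * (t : ℂ) ^ (u - 1) *
      ₂F₁ a b c ((t : ℂ) ^ 2)) MeasureTheory.volume 0 1 ∧
    ∫ t in (0 : ℝ)..1, (1 - (t : ℂ)) ^ (v - 1) * (t : ℂ) ^ (u - 1) * ₂F₁ a b c ((t : ℂ) ^ 2) =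
      Complex.betaIntegral u v * ∑' n : ℕ, (ascPochhammer ℂ n).eval a *
        (ascPochhammer ℂ n).eval b / ((ascPochhammer ℂ n).eval c * (n.factorial : ℂ)) *
          ((ascPochhammer ℂ n).eval (u / 2) / (ascPochhammer ℂ n).eval ((u + v) / 2) *
            ((ascPochhammer ℂ n).eval ((u + 1) / 2) /
              (ascPochhammer ℂ n).eval ((u + v + 1) / 2))) := by
  set d : ℕ → ℂ := fun n => (ascPochhammer ℂ n).eval a *
    (ascPochhammer ℂ n).eval b / ((ascPochhammer ℂ n).eval c * (n.factorial : ℂ)) with hd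
  have hF : ∀ x : ℂ, ₂F₁ a b c x = ∑' n, d n * x ^ n := fun x => by
    rw [ordinaryHypergeometric_eq_tsum]
    refine tsum_congr fun n => ?_
    simp only [hd, smul_eq_mul]
    ring
  have hsum : Summable fun n => ‖d n‖ *
      ‖Complex.betaIntegral ((u + 2 * n).re : ℝ) (v.re : ℝ)‖ := by
    have h1 := isBigO_ascPochhammer_div_ascPochhammer a c hc
    have h2 := isBigO_ascPochhammer_div_ascPochhammer b 1 (ne_neg_natCast_of_re_pos (by simp))
    have h3 := isBigO_betaIntegral_add_two_mul (u := (u.re : ℂ)) (v := (v.re : ℂ))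
      (by simpa using hu) (by simpa using hv)
    have habc' := congrArg Complex.re habc
    refine Summable.congr (summable_of_isBigO_rpow_mul_rpow_mul_rpow
      ((h1.mul h2).norm_left.mul h3.norm_left) ?_) fun n => ?_
    · simp only [Complex.add_re, Complex.sub_re, Complex.one_re, Complex.ofReal_re] at habc' ⊢
      linarith
    · rw [ascPochhammer_eval_one, div_mul_div_comm]
      congr 3
      simp
  obtain ⟨h1, h2⟩ := integral_betaKernel_mul_tsum hu hv hsum
  simp_rw [hF]
  refine ⟨h1, h2.trans ?_⟩
  rw [← tsum_mul_left]
  refine tsum_congr fun n => ?_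
  rw [betaIntegral_add_two_mul hu hv]
  ring

/-! ### The two integrals -/

/-- The quotient of Gamma functions left by the Beta integral and Gauss' formula, simplified by
the duplication formula. -/
theorem betaIntegral_mul_gauss_eq {γ ε : ℂ} (hγ : γ.re < 1) (hε : -1 < ε.re) :
    Complex.betaIntegral (1 - γ) (1 + ε) * (Complex.Gamma (ε / 2 + (1 - γ) / 2 + 1) /
        (Complex.Gamma (ε / 2 + 1) * Complex.Gamma ((1 - γ) / 2 + 1))) =
      Complex.Gamma (1 - γ / 2) * Complex.Gamma (1 / 2 + ε / 2) /
        ((Real.sqrt Real.pi : ℂ) * (1 - γ) * Complex.Gamma (1 + ε / 2 - γ / 2)) := by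
  have hu : 0 < (1 - γ).re := by simp; linarith
  have hv : 0 < (1 + ε).re := by simp; linarith
  have hu0 : 1 - γ ≠ 0 := fun h => by rw [h] at hu; simp at hu
  have hpi : (Real.sqrt Real.pi : ℂ) ≠ 0 := by
    exact_mod_cast (Real.sqrt_pos.2 Real.pi_pos).ne'
  have hpow : ∀ s : ℂ, (2 : ℂ) ^ s ≠ 0 := fun s => by simp [Complex.cpow_eq_zero_iff]
  have d1 := Complex.Gamma_mul_Gamma_add_half ((1 - γ) / 2)
  have d2 := Complex.Gamma_mul_Gamma_add_half ((1 + ε) / 2)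
  have d3 := Complex.Gamma_mul_Gamma_add_half (1 + ε / 2 - γ / 2)
  rw [show 2 * ((1 - γ) / 2) = 1 - γ by ring, show (1 - γ) / 2 + 1 / 2 = 1 - γ / 2 by ring,
    show 1 - (1 - γ) = γ by ring] at d1
  rw [show 2 * ((1 + ε) / 2) = 1 + ε by ring, show (1 + ε) / 2 + 1 / 2 = ε / 2 + 1 by ring,
    show 1 - (1 + ε) = -ε by ring] at d2
  rw [show 2 * (1 + ε / 2 - γ / 2) = 1 - γ + (1 + ε) by ring,
    show 1 + ε / 2 - γ / 2 + 1 / 2 = ε / 2 + (1 - γ) / 2 + 1 by ring,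
    show 1 - (1 - γ + (1 + ε)) = -1 + γ + -ε by ring,
    Complex.cpow_add _ _ two_ne_zero, Complex.cpow_add _ _ two_ne_zero,
    Complex.cpow_neg_one] at d3
  rw [Complex.betaIntegral_eq_Gamma_mul_div _ _ hu hv,
    Complex.Gamma_add_one ((1 - γ) / 2) (div_ne_zero hu0 two_ne_zero),
    show 1 / 2 + ε / 2 = (1 + ε) / 2 by ring]
  have g1 : Complex.Gamma (1 - γ + (1 + ε)) ≠ 0 :=
    Complex.Gamma_ne_zero_of_re_pos (by rw [Complex.add_re]; linarith)
  have g2 : Complex.Gamma (ε / 2 + 1) ≠ 0 :=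
    Complex.Gamma_ne_zero_of_re_pos (by simp; linarith)
  have g3 : Complex.Gamma ((1 - γ) / 2) ≠ 0 :=
    Complex.Gamma_ne_zero_of_re_pos (by simp; linarith)
  have g4 : Complex.Gamma (1 + ε / 2 - γ / 2) ≠ 0 :=
    Complex.Gamma_ne_zero_of_re_pos (by simp; linarith)
  have p1 := hpow γ
  have p2 := hpow (-ε)
  have e1 : Complex.Gamma (1 - γ) = Complex.Gamma ((1 - γ) / 2) * Complex.Gamma (1 - γ / 2) /
      (2 ^ γ * (Real.sqrt Real.pi : ℂ)) := by
    rw [d1]; field_simp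
  have e2 : Complex.Gamma (1 + ε) = Complex.Gamma ((1 + ε) / 2) * Complex.Gamma (ε / 2 + 1) /
      (2 ^ (-ε) * (Real.sqrt Real.pi : ℂ)) := by
    rw [d2]; field_simp
  have e3 : Complex.Gamma (ε / 2 + (1 - γ) / 2 + 1) = Complex.Gamma (1 - γ + (1 + ε)) *
      (2⁻¹ * 2 ^ γ * 2 ^ (-ε)) * (Real.sqrt Real.pi : ℂ) / Complex.Gamma (1 + ε / 2 - γ / 2) := by
    rw [eq_div_iff g4, mul_comm, d3]
  rw [e1, e2, e3]
  clear e1 e2 e3 d1 d2 d3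
  generalize Complex.Gamma (1 - γ + (1 + ε)) = G₁ at *
  generalize Complex.Gamma (ε / 2 + 1) = G₂ at *
  generalize Complex.Gamma ((1 - γ) / 2) = G₃ at *
  generalize Complex.Gamma (1 + ε / 2 - γ / 2) = G₄ at *
  field_simp

theorem heunIntegrand₁_integral {γ ε : ℂ} (hγ : γ.re < 1) (hε : -1 < ε.re) :
    IntervalIntegrable (heunIntegrand₁ γ ε) MeasureTheory.volume 0 1 ∧
    ∫ t in (0 : ℝ)..1, heunIntegrand₁ γ ε t =
      Complex.Gamma (1 - γ / 2) * Complex.Gamma (1 / 2 + ε / 2) /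
        ((Real.sqrt Real.pi : ℂ) * (1 - γ) * Complex.Gamma (1 + ε / 2 - γ / 2)) := by
  have hc : ∀ k : ℕ, 1 - γ / 2 ≠ -k := ne_neg_natCast_of_re_pos (by simp; linarith)
  have hb : ∀ k : ℕ, 1 + (ε - γ) / 2 ≠ -k := ne_neg_natCast_of_re_pos (by simp; linarith)
  obtain ⟨h1, h2⟩ := integral_betaKernel_mul_hypergeometric (u := 1 - γ) (v := 1 + ε)
    (a := ε / 2) (b := 1 + (ε - γ) / 2) (c := 1 - γ / 2) (by simp; linarith) (by simp; linarith)
    hc (by ring)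
  have hfun : heunIntegrand₁ γ ε = fun t : ℝ => (1 - (t : ℂ)) ^ (1 + ε - 1) *
      (t : ℂ) ^ (1 - γ - 1) * ₂F₁ (ε / 2) (1 + (ε - γ) / 2) (1 - γ / 2) ((t : ℂ) ^ 2) := by
    funext t
    rw [heunIntegrand₁]
    ring_nf
  rw [hfun]
  refine ⟨h1, h2.trans ?_⟩
  rw [← betaIntegral_mul_gauss_eq hγ hε]
  congr 1
  -- Two of the symbols `(x/2)ₙ`, `((x+1)/2)ₙ` cancel against parameters of the `₂F₁`.
  refine Eq.trans (tsum_congr fun n => ?_) (hasSum_gauss_of_eq_add_add_one (a := ε / 2)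
    (b := (1 - γ) / 2) (ne_neg_natCast_of_re_pos (by simp; linarith))).tsum_eq
  have hc' := ascPochhammer_eval_ne_zero hc n
  have hb' := ascPochhammer_eval_ne_zero hb n
  rw [show (1 - γ + (1 + ε)) / 2 = 1 + (ε - γ) / 2 by ring,
    show (1 - γ + 1) / 2 = 1 - γ / 2 by ring,
    show (1 - γ + (1 + ε) + 1) / 2 = ε / 2 + (1 - γ) / 2 + 1 by ring]
  generalize (ascPochhammer ℂ n).eval (1 - γ / 2) = X at *
  generalize (ascPochhammer ℂ n).eval (1 + (ε - γ) / 2) = Y at *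
  field_simp

theorem heunIntegrand₂_integral {γ ε : ℂ} (hε : -1 < ε.re) (hγ : ∀ k : ℕ, 1 + γ / 2 ≠ -k) :
    IntervalIntegrable (heunIntegrand₂ γ ε) MeasureTheory.volume 0 1 ∧
    ∫ t in (0 : ℝ)..1, heunIntegrand₂ γ ε t =
      1 / (1 + ε) * clausen (1 / 2) 1 ((ε + γ) / 2) (1 + γ / 2) (3 / 2 + ε / 2) := by
  have ha : ∀ k : ℕ, 1 + ε / 2 ≠ -k := ne_neg_natCast_of_re_pos (by simp; linarith)
  have hv : 0 < (1 + ε).re := by simp; linarith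
  obtain ⟨h1, h2⟩ := integral_betaKernel_mul_hypergeometric (u := 1) (v := 1 + ε)
    (a := 1 + ε / 2) (b := (ε + γ) / 2) (c := 1 + γ / 2) (by simp) hv hγ (by ring)
  have hfun : heunIntegrand₂ γ ε = fun t : ℝ => (1 - (t : ℂ)) ^ (1 + ε - 1) *
      (t : ℂ) ^ ((1 : ℂ) - 1) * ₂F₁ (1 + ε / 2) ((ε + γ) / 2) (1 + γ / 2) ((t : ℂ) ^ 2) := by
    funext t
    rw [heunIntegrand₂, sub_self, Complex.cpow_zero, mul_one, add_sub_cancel_left]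
  rw [hfun]
  refine ⟨h1, h2.trans ?_⟩
  rw [Complex.betaIntegral_symm, Complex.betaIntegral_eval_one_right hv]
  congr 1
  refine tsum_congr fun n => ?_
  have ha' := ascPochhammer_eval_ne_zero ha n
  rw [clausenTerm, show (1 + (1 + ε)) / 2 = 1 + ε / 2 by ring,
    show ((1 : ℂ) + 1) / 2 = 1 by ring,
    show (1 + (1 + ε) + 1) / 2 = 3 / 2 + ε / 2 by ring]
  generalize (ascPochhammer ℂ n).eval (1 + ε / 2) = X at *
  field_simp

/-! ### The Saalschützian case and the value at `1` -/

theorem Gamma_quotient_saalschutz {γ ε : ℂ} (hγ : γ.re < 0) (hε : -1 < ε.re) (hε0 : ε ≠ 0) :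
    Complex.Gamma (1 / 2 - γ / 2) * Complex.Gamma (1 - γ / 2) *
        Complex.Gamma (ε / 2) * Complex.Gamma (3 / 2 + ε / 2) /
      (Complex.Gamma (3 / 2 - γ / 2) * Complex.Gamma (-γ / 2) *
        Complex.Gamma (1 + ε / 2) * Complex.Gamma (1 / 2 + ε / 2)) =
      γ * (1 + ε) / ((γ - 1) * ε) := by
  have a1 : 0 < (1 / 2 - γ / 2).re := by simp; linarith
  have a2 : 0 < (-γ / 2).re := by simp; linarith
  have a3 : 0 < (1 + ε / 2).re := by simp; linarith
  have a4 : 0 < (1 / 2 + ε / 2).re := by simp; linarith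
  have n1 : 1 / 2 - γ / 2 ≠ 0 := fun h => by rw [h] at a1; simp at a1
  have n2 : -γ / 2 ≠ 0 := fun h => by rw [h] at a2; simp at a2
  have n4 : 1 / 2 + ε / 2 ≠ 0 := fun h => by rw [h] at a4; simp at a4
  have n3 : ε / 2 ≠ 0 := div_ne_zero hε0 two_ne_zero
  have g1 := Complex.Gamma_ne_zero_of_re_pos a1
  have g2 := Complex.Gamma_ne_zero_of_re_pos a2
  have g3 := Complex.Gamma_ne_zero_of_re_pos a3
  have g4 := Complex.Gamma_ne_zero_of_re_pos a4
  have hγ1 : γ - 1 ≠ 0 := fun h => n1 (by linear_combination -h / 2)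
  rw [show 3 / 2 - γ / 2 = 1 / 2 - γ / 2 + 1 by ring, show 1 - γ / 2 = -γ / 2 + 1 by ring,
    show 3 / 2 + ε / 2 = 1 / 2 + ε / 2 + 1 by ring, Complex.Gamma_add_one _ n1,
    Complex.Gamma_add_one _ n2, Complex.Gamma_add_one _ n4]
  rw [add_comm 1 (ε / 2), Complex.Gamma_add_one _ n3] at g3 ⊢
  have g3' := right_ne_zero_of_mul g3
  have n1' : 1 - γ ≠ 0 := fun h => hγ1 (by linear_combination -h)
  generalize Complex.Gamma (1 / 2 - γ / 2) = G₁ at *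
  generalize Complex.Gamma (-γ / 2) = G₂ at *
  generalize Complex.Gamma (ε / 2) = G₃ at *
  generalize Complex.Gamma (1 / 2 + ε / 2) = G₄ at *
  field_simp
  ring

theorem clausen_saalschutz {γ ε : ℂ} {N : ℕ} (hq : (γ - 1) * ε ≠ 0)
    (hd : ∀ k : ℕ, 1 + γ / 2 ≠ -k) (he : ∀ k : ℕ, 3 / 2 + ε / 2 ≠ -k) (h : γ + ε = -2 * N) :
    clausen (1 / 2) 1 ((ε + γ) / 2) (1 + γ / 2) (3 / 2 + ε / 2) =
      γ * (1 + ε) / ((γ - 1) * ε) := by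
  obtain rfl : ε = -2 * N - γ := by linear_combination h
  have hK : (1 + γ / 2 - 1) * (3 / 2 + (-2 * N - γ) / 2 - 1) + 1 / 2 * N =
      (γ - 1) * (-2 * N - γ) / 4 := by ring
  rw [show (-2 * N - γ + γ) / 2 = -(N : ℂ) by ring,
    clausen_one_neg_nat hd he (by ring) (by rw [hK]; exact div_ne_zero hq (by norm_num)), hK]
  field_simp
  ring

theorem tendsto_intervalIntegral_nhdsLT_one {f : ℝ → ℂ}
    (hf : IntervalIntegrable f MeasureTheory.volume 0 1) :
    Tendsto (fun z : ℝ => ∫ t in (0 : ℝ)..z, f t) (𝓝[<] 1) (𝓝 (∫ t in (0 : ℝ)..1, f t)) := by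
  have h := intervalIntegral.continuousOn_primitive_interval' hf Set.left_mem_uIcc 1
    Set.right_mem_uIcc
  refine h.tendsto.mono_left ?_
  rw [Set.uIcc_of_le zero_le_one]
  exact nhdsWithin_le_of_mem (Icc_mem_nhdsLT zero_lt_one)

theorem mainTheorem5 (γ ε q C₁ C₂ : ℂ)
    (hq : q = (γ - 1) * ε) (hq0 : q ≠ 0)
    (hε : -1 < ε.re)
    (hγ : C₁ = 0 ∨ γ.re < 1)
    (hγ' : ∀ k : ℕ, γ ≠ -2 * ((k : ℂ) + 1)) :
    -- the integrals up to `1` and the series in the result converge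
    (γ.re < 1 → IntervalIntegrable (heunIntegrand₁ γ ε) MeasureTheory.volume 0 1) ∧
    IntervalIntegrable (heunIntegrand₂ γ ε) MeasureTheory.volume 0 1 ∧
    Summable (clausenTerm (1 / 2) 1 ((ε + γ) / 2) (1 + γ / 2) (3 / 2 + ε / 2)) ∧
    -- `u(1)` is the limit of `u(z)` as `z` increases to `1`
    Tendsto (heunSolution γ ε q C₁ C₂) (𝓝[<] 1) (𝓝 (heunSolution γ ε q C₁ C₂ 1)) ∧
    -- the value `u(1)`
    heunSolution γ ε q C₁ C₂ 1 =
      C₁ * (Complex.Gamma (1 - γ / 2) * Complex.Gamma (1 / 2 + ε / 2) /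
        ((Real.sqrt Real.pi : ℂ) * (1 - γ) * Complex.Gamma (1 + ε / 2 - γ / 2))) +
      C₂ * (-γ / q +
        1 / (1 + ε) * clausen (1 / 2) 1 ((ε + γ) / 2) (1 + γ / 2) (3 / 2 + ε / 2)) ∧
    -- the Saalschützian case
    ∀ N : ℕ, 1 ≤ N → γ + ε = -2 * (N : ℂ) →
      IsSaalschutzian (1 / 2) 1 ((ε + γ) / 2) (1 + γ / 2) (3 / 2 + ε / 2) ∧
      clausen (1 / 2) 1 ((ε + γ) / 2) (1 + γ / 2) (3 / 2 + ε / 2) =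
        Complex.Gamma (1 / 2 - γ / 2) * Complex.Gamma (1 - γ / 2) *
            Complex.Gamma (ε / 2) * Complex.Gamma (3 / 2 + ε / 2) /
          (Complex.Gamma (3 / 2 - γ / 2) * Complex.Gamma (-γ / 2) *
            Complex.Gamma (1 + ε / 2) * Complex.Gamma (1 / 2 + ε / 2)) ∧
      heunSolution γ ε q C₁ C₂ 1 =
        C₁ * (Complex.Gamma (1 - γ / 2) * Complex.Gamma (1 / 2 + ε / 2) /
          ((Real.sqrt Real.pi : ℂ) * (1 - γ) * Complex.Gamma (1 + ε / 2 - γ / 2))) +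
        C₂ * (-γ / q + 1 / (1 + ε) *
          (Complex.Gamma (1 / 2 - γ / 2) * Complex.Gamma (1 - γ / 2) *
              Complex.Gamma (ε / 2) * Complex.Gamma (3 / 2 + ε / 2) /
            (Complex.Gamma (3 / 2 - γ / 2) * Complex.Gamma (-γ / 2) *
              Complex.Gamma (1 + ε / 2) * Complex.Gamma (1 / 2 + ε / 2)))) ∧
      heunSolution γ ε q C₁ C₂ 1 =
        C₁ * (Complex.Gamma (1 - γ / 2) * Complex.Gamma (1 / 2 + ε / 2) /
          ((Real.sqrt Real.pi : ℂ) * (1 - γ) * Complex.Gamma (1 + ε / 2 - γ / 2))) := by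
  subst hq
  have hγ1 : ∀ k : ℕ, 1 + γ / 2 ≠ -k := fun k h => hγ' k (by linear_combination 2 * h)
  have he : ∀ k : ℕ, 3 / 2 + ε / 2 ≠ -k := ne_neg_natCast_of_re_pos (by simp; linarith)
  obtain ⟨hint₂, hval₂⟩ := heunIntegrand₂_integral hε hγ1
  have hvalue : heunSolution γ ε ((γ - 1) * ε) C₁ C₂ 1 =
      C₁ * (Complex.Gamma (1 - γ / 2) * Complex.Gamma (1 / 2 + ε / 2) /
        ((Real.sqrt Real.pi : ℂ) * (1 - γ) * Complex.Gamma (1 + ε / 2 - γ / 2))) +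
      C₂ * (-γ / ((γ - 1) * ε) +
        1 / (1 + ε) * clausen (1 / 2) 1 ((ε + γ) / 2) (1 + γ / 2) (3 / 2 + ε / 2)) := by
    rw [heunSolution, hval₂]
    rcases hγ with rfl | hγ
    · simp
    · rw [(heunIntegrand₁_integral hγ hε).2]
  refine ⟨fun h => (heunIntegrand₁_integral h hε).1, hint₂, ?_, ?_, hvalue, ?_⟩
  · refine summable_clausenTerm hγ1 he ?_
    simp
    linarith
  · have h₂ := ((tendsto_intervalIntegral_nhdsLT_one hint₂).const_add
      (-γ / ((γ - 1) * ε))).const_mul C₂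
    refine Tendsto.add ?_ h₂
    rcases hγ with rfl | hγ
    · simp
    · exact (tendsto_intervalIntegral_nhdsLT_one (heunIntegrand₁_integral hγ hε).1).const_mul C₁
  · intro N hN h
    have hγ0 : γ.re < 0 := by
      have h' := congrArg Complex.re h
      have hN' : (1 : ℝ) ≤ N := by exact_mod_cast hN
      simp at h'
      linarith
    have hclausen := clausen_saalschutz hq0 hγ1 he h
    have hGamma := Gamma_quotient_saalschutz hγ0 hε (right_ne_zero_of_mul hq0)
    have hε1 : 1 + ε ≠ 0 := fun h0 => he 0 (by
      have : (0 : ℝ) < (1 + ε).re := by simp; linarith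
      simp [h0] at this)
    refine ⟨⟨by ring, N, hN, .inr (.inr (by linear_combination h / 2))⟩,
      hclausen.trans hGamma.symm, ?_, ?_⟩
    · rw [hvalue, hclausen, hGamma]
    · have hzero : -γ / ((γ - 1) * ε) + 1 / (1 + ε) * (γ * (1 + ε) / ((γ - 1) * ε)) = 0 := by
        rw [one_div_mul_eq_div, mul_div_right_comm γ, neg_div]
        field_simp
        ring
      rw [hvalue, hclausen, hzero, mul_zero, add_zero]
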